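/- Let $\mathcal S$ be a compact Hausdorff semitopological semigroup compactification of $\mathbb Z$: a semigroup $(\mathcal S,+)$ with a compact Hausdorff topology for which addition is separately continuous, together with an injective semigroup homomorphism $\mathbb Z\to\mathcal S$ with dense range, through which $\mathbb Z$ is regarded as a subset of $\mathcal S$. Let $M(\mathcal S)=C(\mathcal S)^*$ (complex scalars), with the convolution $\langle\Phi*\Psi,f\rangle=\iint f(s+t)\,d\Phi(s)\,d\Psi(t)$ for $f\in C(\mathcal S)$, and regard $\ell_1(\mathbb Z)$ as a subspace of $M(\mathcal S)$. Let $\Theta:M(\mathcal S)\to\ell_1(\mathbb Z)$ be a bounded projection onto $\ell_1(\mathbb Z)$ that is a homomorphism for convolution and whose kernel is weak*-closed. The pair $(\mathcal S,\Theta)$ then induces the shift-invariant predual $E\subseteq\ell_\infty(\mathbb Z)$ of $\ell_1(\mathbb Z)$ consisting of the restrictions to $\mathbb Z$ of those $f\in C(\mathcal S)$ with $\langle\Psi,f\rangle=0$ for all $\Psi\in\ker\Theta$. Suppose that $(\mathcal S,\Theta)$ is minimal, that is, that the map $\mathcal S\to\ell_1(\mathbb Z)$, $\gamma\mapsto\Theta(\delta_\gamma)$,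 is injective. Then $\mathcal S$ has exactly two idempotents: $0\in\mathbb Z$ and another element, denoted $\infty$. Moreover $\infty$ is a semigroup zero, i.e. $\infty+\gamma=\gamma+\infty=\infty$ for all $\gamma\in\mathcal S$; and for every $\gamma\in\mathcal S$ with $\gamma\neq0$, $\infty$ lies in the closure of $\{n\gamma:n\in\mathbb N\}$, where $\mathbb N=\{1,2,3,\dots\}$. -/

import Mathlib

noncomputable section

namespace ShiftPredual

open Filter Topology MeasureTheory
open scoped NNReal ENNReal CompactlySupported

/-! ### Integrating a separately continuous function

The helper facts of this section show that `t ↦ ∫ f(s + t) dΦ(s)` is continuous on a compact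
semitopological semigroup, so that convolution of functionals is well defined. -/

section Aux

variable {X : Type*} [TopologicalSpace X]

/-- The numbers `Re Φ(h)` with `|h| ≤ g`; their supremum is the integral of `g` against the total
variation of `Φ`. -/
def varSet (Φ : StrongDual ℂ C(X, ℂ)) (g : X → ℝ≥0) : Set ℝ :=
  {r | ∃ h : C(X, ℂ), (∀ x, ‖h x‖ ≤ g x) ∧ r = (Φ h).re}

theorem varSet_nonempty (Φ : StrongDual ℂ C(X, ℂ)) (g : X → ℝ≥0) : (0 : ℝ) ∈ varSet Φ g :=
  ⟨0, by simp, by simp⟩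

variable [CompactSpace X]

theorem varSet_bdd (Φ : StrongDual ℂ C(X, ℂ)) (g : C(X, ℝ≥0)) : BddAbove (varSet Φ g) := by
  obtain ⟨C, hC⟩ := (isCompact_range g.continuous).bddAbove
  refine ⟨‖Φ‖ * C, ?_⟩
  rintro r ⟨h, hh, rfl⟩
  calc (Φ h).re ≤ ‖Φ h‖ := Complex.re_le_norm _
    _ ≤ ‖Φ‖ * ‖h‖ := Φ.le_opNorm h
    _ ≤ ‖Φ‖ * C := by
        gcongr
        refine (ContinuousMap.norm_le _ C.2).2 fun x => (hh x).trans ?_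
        exact_mod_cast hC ⟨x, rfl⟩

theorem var_add (Φ : StrongDual ℂ C(X, ℂ)) (g k : C(X, ℝ≥0)) :
    sSup (varSet Φ (g + k)) = sSup (varSet Φ g) + sSup (varSet Φ k) := by
  apply le_antisymm
  · refine csSup_le ⟨0, varSet_nonempty Φ _⟩ ?_
    rintro r ⟨h, hh, rfl⟩
    refine le_of_forall_pos_le_add fun ε hε => ?_
    obtain ⟨d, hd, hdε⟩ : ∃ d : ℝ, 0 < d ∧ ‖Φ‖ * d ≤ ε :=
      ⟨ε / (‖Φ‖ + 1), by positivity, by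
        rw [mul_div_assoc', div_le_iff₀ (by positivity)]; nlinarith [norm_nonneg Φ]⟩
    have hpos : ∀ x, 0 < (g x : ℝ) + k x + d := fun x => by positivity
    let cut : C(X, ℝ) → C(X, ℂ) := fun u =>
      ⟨fun x => ((u x / (g x + k x + d) : ℝ) : ℂ) * h x, by
        refine (Complex.continuous_ofReal.comp ?_).mul h.continuous
        exact u.continuous.div (by fun_prop) fun x => (hpos x).ne'⟩
    have hcut : ∀ (u : C(X, ℝ)), (∀ x, 0 ≤ u x) → ∀ x, ‖cut u x‖ ≤ u x := by
      intro u hu x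
      change ‖((u x / (g x + k x + d) : ℝ) : ℂ) * h x‖ ≤ u x
      rw [norm_mul, Complex.norm_real, Real.norm_of_nonneg (div_nonneg (hu x) (hpos x).le),
        div_mul_eq_mul_div, div_le_iff₀ (hpos x)]
      have := hh x
      simp at this
      exact mul_le_mul_of_nonneg_left (by linarith) (hu x)
    let gr : C(X, ℝ) := ⟨fun x => g x, by fun_prop⟩
    let kr : C(X, ℝ) := ⟨fun x => k x, by fun_prop⟩
    have hsum : h = cut gr + cut kr + cut (ContinuousMap.const X d) := by
      ext x
      change h x = ((g x / (g x + k x + d) : ℝ) : ℂ) * h x + ((k x / (g x + k x + d) : ℝ) : ℂ) * h x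
        + ((d / (g x + k x + d) : ℝ) : ℂ) * h x
      rw [← add_mul, ← add_mul, ← Complex.ofReal_add, ← Complex.ofReal_add, ← add_div, ← add_div,
        div_self (hpos x).ne']
      simp
    have h1 : (Φ (cut gr)).re ≤ sSup (varSet Φ g) :=
      le_csSup (varSet_bdd Φ g) ⟨_, hcut gr fun x => (g x).2, rfl⟩
    have h2 : (Φ (cut kr)).re ≤ sSup (varSet Φ k) :=
      le_csSup (varSet_bdd Φ k) ⟨_, hcut kr fun x => (k x).2, rfl⟩
    have h3 : (Φ (cut (ContinuousMap.const X d))).re ≤ ε := by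
      refine (Complex.re_le_norm _).trans ((Φ.le_opNorm _).trans (le_trans ?_ hdε))
      gcongr
      exact (ContinuousMap.norm_le _ hd.le).2 (hcut _ fun _ => hd.le)
    have : (Φ h).re = (Φ (cut gr)).re + (Φ (cut kr)).re
        + (Φ (cut (ContinuousMap.const X d))).re := by
      conv_lhs => rw [hsum]
      simp
    linarith
  · rw [← sub_nonneg, ← sub_sub, sub_nonneg]
    refine csSup_le ⟨0, varSet_nonempty Φ _⟩ ?_
    rintro r ⟨h, hh, rfl⟩
    rw [le_sub_comm]
    refine csSup_le ⟨0, varSet_nonempty Φ _⟩ ?_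
    rintro r ⟨l, hl, rfl⟩
    rw [le_sub_iff_add_le]
    refine le_csSup (varSet_bdd Φ (g + k)) ⟨l + h, fun x => ?_, by simp⟩
    have := norm_add_le (l x) (h x)
    have h1 := hh x
    have h2 := hl x
    simp
    linarith

theorem var_smul_le (Φ : StrongDual ℂ C(X, ℂ)) (c : ℝ≥0) (g : C(X, ℝ≥0)) :
    c * sSup (varSet Φ g) ≤ sSup (varSet Φ (c • g)) := by
  rcases eq_or_ne c 0 with rfl | hc
  · simpa using le_csSup (varSet_bdd Φ ((0 : ℝ≥0) • g)) (varSet_nonempty Φ _)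
  have hc0 : (0 : ℝ) < c := by positivity
  rw [← le_div_iff₀' hc0]
  refine csSup_le ⟨0, varSet_nonempty Φ _⟩ ?_
  rintro r ⟨h, hh, rfl⟩
  rw [le_div_iff₀' hc0]
  refine le_csSup (varSet_bdd Φ (c • g)) ⟨((c : ℝ) : ℂ) • h, fun x => ?_, by simp⟩
  simpa using mul_le_mul_of_nonneg_left (hh x) hc0.le

theorem var_smul (Φ : StrongDual ℂ C(X, ℂ)) (c : ℝ≥0) (g : C(X, ℝ≥0)) :
    sSup (varSet Φ (c • g)) = c * sSup (varSet Φ g) := by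
  refine le_antisymm ?_ (var_smul_le Φ c g)
  rcases eq_or_ne c 0 with rfl | hc
  · refine csSup_le ⟨0, varSet_nonempty Φ _⟩ ?_
    rintro r ⟨h, hh, rfl⟩
    have : h = 0 := by ext x; simpa using hh x
    simp [this]
  · have := var_smul_le Φ c⁻¹ (c • g)
    rw [ContinuousMap.coe_smul, smul_smul, inv_mul_cancel₀ hc, one_smul, NNReal.coe_inv] at this
    rwa [inv_mul_le_iff₀ (by positivity)] at this

variable [T2Space X]

theorem exists_dominating_measure [MeasurableSpace X] [BorelSpace X]
    (Φ : StrongDual ℂ C(X, ℂ)) :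
    ∃ μ : Measure X, IsFiniteMeasure μ ∧ ∀ f : C(X, ℂ), ‖Φ f‖ ≤ ∫ x, ‖f x‖ ∂μ := by
  have hP0 : ∀ g : C(X, ℝ≥0), 0 ≤ sSup (varSet Φ g) := fun g =>
    le_csSup (varSet_bdd Φ g) (varSet_nonempty Φ g)
  let P : C_c(X, ℝ≥0) →ₗ[ℝ≥0] ℝ≥0 :=
    { toFun := fun g => ⟨sSup (varSet Φ g), hP0 g.toContinuousMap⟩
      map_add' := fun g k => NNReal.eq (var_add Φ g.toContinuousMap k.toContinuousMap)
      map_smul' := fun c g => NNReal.eq (var_smul Φ c g.toContinuousMap) }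
  refine ⟨NNRealRMK.rieszMeasure P, inferInstance, fun f => ?_⟩
  let g : C_c(X, ℝ≥0) :=
    ⟨⟨fun x => ‖f x‖₊, by fun_prop⟩, HasCompactSupport.of_compactSpace _⟩
  have hg := NNRealRMK.integral_rieszMeasure P g
  change ∫ x, ‖f x‖ ∂_ = sSup (varSet Φ g) at hg
  rw [hg]
  obtain ⟨c, hc, hcf⟩ : ∃ c : ℂ, ‖c‖ = 1 ∧ c * Φ f = ‖Φ f‖ := by
    rcases eq_or_ne (Φ f) 0 with h | h
    · exact ⟨1, by simp, by simp [h]⟩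
    · refine ⟨‖Φ f‖ / Φ f, by simp [h], by field_simp⟩
  refine le_csSup (varSet_bdd Φ g.toContinuousMap) ⟨c • f, fun x => ?_, ?_⟩
  · simp [hc, g]
  · simp [hcf]

/-- A bounded sequence of continuous functions that tends to zero pointwise tends to zero
weakly. -/
theorem tendsto_of_bounded_pointwise (Φ : StrongDual ℂ C(X, ℂ)) (f : ℕ → C(X, ℂ)) (M : ℝ)
    (hM : ∀ n x, ‖f n x‖ ≤ M) (hf : ∀ x, Tendsto (fun n => f n x) atTop (𝓝 0)) :
    Tendsto (fun n => Φ (f n)) atTop (𝓝 0) := by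
  let _ : MeasurableSpace X := borel X
  have : BorelSpace X := ⟨rfl⟩
  obtain ⟨μ, hμ, hle⟩ := exists_dominating_measure Φ
  refine squeeze_zero_norm (fun n => hle (f n)) ?_
  have := tendsto_integral_of_dominated_convergence (μ := μ) (F := fun n x => ‖f n x‖)
    (f := fun _ => (0 : ℝ)) (fun _ => M)
    (fun n => (f n).continuous.norm.aestronglyMeasurable) (integrable_const M)
    (fun n => .of_forall fun x => by simpa using hM n x)
    (.of_forall fun x => by simpa using (hf x).norm)
  simpa using this

/-- A bounded functional integrates a separately continuous bounded function to a continuous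
function. -/
theorem continuous_apply_of_separately {K : Type*} [TopologicalSpace K] [CompactSpace K]
    (Φ : StrongDual ℂ C(X, ℂ)) (F : K → C(X, ℂ)) (M : ℝ) (hM : ∀ t x, ‖F t x‖ ≤ M)
    (hF : ∀ x, Continuous fun t => F t x) : Continuous fun t => Φ (F t) := by
  rw [continuous_iff_continuousAt]
  intro t₀
  by_contra hcon
  obtain ⟨ε, hε, hfreq⟩ : ∃ ε > 0, ∃ᶠ t in 𝓝 t₀, ε ≤ ‖Φ (F t) - Φ (F t₀)‖ := by
    rw [ContinuousAt, Metric.tendsto_nhds] at hcon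
    push Not at hcon
    obtain ⟨ε, hε, h⟩ := hcon
    exact ⟨ε, hε, h.mono fun t ht => by rwa [dist_eq_norm] at ht⟩
  -- finite nets for finitely many of the functions
  have hnet : ∀ (T : Finset K) (δ : ℝ), 0 < δ → ∃ D : Finset X, ∀ x, ∃ d ∈ D, ∀ t ∈ T,
      ‖F t x - F t d‖ < δ := by
    intro T δ hδ
    obtain ⟨D, hD⟩ := isCompact_univ.elim_nhds_subcover
      (fun d => {x | ∀ t ∈ T, ‖F t x - F t d‖ < δ}) fun d _ => by
        have : ∀ t ∈ T, ∀ᶠ x in 𝓝 d, ‖F t x - F t d‖ < δ := fun t _ => by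
          have : ContinuousAt (F t) d := (F t).continuous.continuousAt
          simpa [dist_eq_norm] using Metric.tendsto_nhds.1 this δ hδ
        exact (Filter.eventually_all_finset T).2 this
    refine ⟨D, fun x => ?_⟩
    obtain ⟨d, hd, hx⟩ := Set.mem_iUnion₂.1 (hD.2 (Set.mem_univ x))
    exact ⟨d, hd, hx⟩
  have hpick : ∀ (D : Finset X) (δ : ℝ), 0 < δ → ∃ t, ε ≤ ‖Φ (F t) - Φ (F t₀)‖ ∧
      ∀ d ∈ D, ‖F t d - F t₀ d‖ < δ := by
    intro D δ hδ
    have : ∀ d ∈ D, ∀ᶠ t in 𝓝 t₀, ‖F t d - F t₀ d‖ < δ := fun d _ => by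
      simpa [dist_eq_norm] using Metric.tendsto_nhds.1 (hF d).continuousAt δ hδ
    obtain ⟨t, h1, h2⟩ := (hfreq.and_eventually ((Filter.eventually_all_finset D).2 this)).exists
    exact ⟨t, h1, h2⟩
  classical
  choose net hnet using hnet
  choose pick hpick1 hpick2 using hpick
  let δ : ℕ → ℝ := fun n => 1 / ((n : ℝ) + 1)
  have hδ : ∀ n, 0 < δ n := fun n => by positivity
  let step : ℕ → Finset K × Finset X → Finset K × Finset X := fun n p =>
    (insert (pick (p.2 ∪ net p.1 (δ n) (hδ n)) (δ n) (hδ n)) p.1, p.2 ∪ net p.1 (δ n) (hδ n))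
  let p : ℕ → Finset K × Finset X := fun n => Nat.rec ({t₀}, ∅) step n
  have hp : ∀ n, p (n + 1) = step n (p n) := fun n => rfl
  let t : ℕ → K := fun n => pick (p (n + 1)).2 (δ n) (hδ n)
  have hTmono : Monotone fun n => (p n).1 :=
    monotone_nat_of_le_succ fun n => by rw [hp]; exact Finset.subset_insert _ _
  have hDmono : Monotone fun n => (p n).2 :=
    monotone_nat_of_le_succ fun n => by rw [hp]; exact Finset.subset_union_left
  have ht₀ : ∀ n, t₀ ∈ (p n).1 := fun n => hTmono n.zero_le (Finset.mem_singleton_self t₀)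
  have ht : ∀ n, t n ∈ (p (n + 1)).1 := fun n => Finset.mem_insert_self _ _
  have hA : ∀ m, ∀ d ∈ (p m).2, Tendsto (fun n => F (t n) d) atTop (𝓝 (F t₀ d)) := by
    intro m d hd
    rw [tendsto_iff_norm_sub_tendsto_zero]
    refine squeeze_zero' (.of_forall fun n => norm_nonneg _) ?_
      tendsto_one_div_add_atTop_nhds_zero_nat
    filter_upwards [eventually_ge_atTop m] with n hn
    exact (hpick2 _ _ _ d (hDmono (hn.trans n.le_succ) hd)).le
  have hlim : ∀ x, Tendsto (fun n => F (t n) x) atTop (𝓝 (F t₀ x)) := by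
    intro x
    have hB : ∀ n, ∃ d ∈ (p (n + 1)).2, ∀ s ∈ (p n).1, ‖F s x - F s d‖ < δ n := fun n => by
      obtain ⟨d, hd, h⟩ := hnet (p n).1 (δ n) (hδ n) x
      exact ⟨d, Finset.mem_union_right _ hd, h⟩
    choose d hdmem hd using hB
    rw [tendsto_iff_ultrafilter]
    intro U hU
    obtain ⟨tl, -, htl⟩ := isCompact_univ.ultrafilter_le_nhds (U.map t) (by simp)
    obtain ⟨dl, -, hdl⟩ := isCompact_univ.ultrafilter_le_nhds (U.map d) (by simp)
    replace htl : Tendsto t U (𝓝 tl) := htl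
    replace hdl : Tendsto d U (𝓝 dl) := hdl
    have hcol : ∀ s m, s ∈ (p m).1 → F s dl = F s x := by
      intro s m hs
      refine tendsto_nhds_unique (((F s).continuous.tendsto dl).comp hdl) ?_
      refine Tendsto.mono_left ?_ hU
      rw [tendsto_iff_norm_sub_tendsto_zero]
      refine squeeze_zero' (.of_forall fun n => norm_nonneg _) ?_
        tendsto_one_div_add_atTop_nhds_zero_nat
      filter_upwards [eventually_ge_atTop m] with n hn
      rw [norm_sub_rev]
      exact (hd n s (hTmono hn hs)).le
    have h1 : F tl dl = F tl x := by
      refine tendsto_nhds_unique (((hF dl).tendsto tl).comp htl) ?_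
      refine (((hF x).tendsto tl).comp htl).congr fun n => ?_
      exact (hcol (t n) (n + 1) (ht n)).symm
    have h2 : F tl dl = F t₀ dl := by
      refine tendsto_nhds_unique (((F tl).continuous.tendsto dl).comp hdl) ?_
      refine (((F t₀).continuous.tendsto dl).comp hdl).congr fun n => ?_
      exact tendsto_nhds_unique ((hA (n + 1) (d n) (hdmem n)).mono_left hU)
        (((hF (d n)).tendsto tl).comp htl)
    have h3 : F tl x = F t₀ x := by rw [← h1, h2, hcol t₀ 0 (ht₀ 0)]
    rw [← h3]
    exact ((hF x).tendsto tl).comp htl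
  have key := tendsto_of_bounded_pointwise Φ (fun n => F (t n) - F t₀) (M + M)
    (fun n x => (norm_sub_le _ _).trans (add_le_add (hM _ x) (hM _ x)))
    (fun x => by simpa using (hlim x).sub_const (F t₀ x))
  have hle : ∀ n, ε ≤ ‖Φ (F (t n) - F t₀)‖ := fun n => by
    rw [map_sub]; exact hpick1 _ _ _
  have := ge_of_tendsto' key.norm hle
  simp at this
  linarith

end Aux

/-! ### The spaces -/

/-- The space `M(S)`, that is, the dual of the space `C(S)` of complex continuous functions. -/
abbrev M (S : Type*) [TopologicalSpace S] [CompactSpace S] : Type _ := StrongDual ℂ C(S, ℂ)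

/-- `ℓ¹(ℤ)` with complex scalars. -/
abbrev Ell1 : Type := lp (fun _ : ℤ => ℂ) 1

/-- `ℓ^∞(ℤ)` with complex scalars. -/
abbrev EllInf : Type := lp (fun _ : ℤ => ℂ) ∞

/-- The convolution product of `ℓ¹(ℤ)`. -/
def ell1Conv (a b : Ell1) : ℤ → ℂ := fun n => ∑' k : ℤ, a k * b (n - k)

theorem Ell1.summable_norm (a : Ell1) : Summable fun n => ‖a n‖ := by
  simpa using (lp.memℓp a).summable (by simp)

theorem Ell1.norm_eq (a : Ell1) : ‖a‖ = ∑' n, ‖a n‖ := by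
  simpa using lp.norm_eq_tsum_rpow (p := 1) (by simp) a

section Semigroup

variable {S : Type*} [TopologicalSpace S]

/-! ### Convolution on `M(S)` -/

/-- The function `s ↦ f (s + t)`. -/
def translate [AddSemigroup S] [SeparatelyContinuousAdd S] (f : C(S, ℂ)) (t : S) : C(S, ℂ) :=
  ⟨fun s => f (s + t), f.continuous.comp SeparatelyContinuousAdd.continuous_add_const⟩

variable [CompactSpace S]

section Conv

variable [AddSemigroup S] [SeparatelyContinuousAdd S] [T2Space S]

theorem continuous_apply_translate (Φ : M S) (f : C(S, ℂ)) :
    Continuous fun t => Φ (translate f t) :=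
  continuous_apply_of_separately Φ (translate f) ‖f‖ (fun _ _ => f.norm_coe_le_norm _)
    fun _ => f.continuous.comp SeparatelyContinuousAdd.continuous_const_add

/-- The continuous function `t ↦ ∫ f (s + t) dΦ(s)`. -/
def partialIntegral (Φ : M S) (f : C(S, ℂ)) : C(S, ℂ) :=
  ⟨fun t => Φ (translate f t), continuous_apply_translate Φ f⟩

/-- The convolution `⟨Φ * Ψ, f⟩ = ∫ ∫ f (s + t) dΦ(s) dΨ(t)`. -/
def conv (Φ Ψ : M S) : M S :=
  LinearMap.mkContinuous
    { toFun := fun f => Ψ (partialIntegral Φ f)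
      map_add' := fun f g => by
        rw [← map_add]
        congr 1
        ext t
        exact map_add Φ (translate f t) (translate g t)
      map_smul' := fun c f => by
        rw [RingHom.id_apply, ← map_smul]
        congr 1
        ext t
        exact map_smul Φ c (translate f t) }
    (‖Ψ‖ * ‖Φ‖) fun f => by
      refine (Ψ.le_opNorm _).trans ?_
      rw [mul_assoc]
      gcongr
      refine (ContinuousMap.norm_le _ (by positivity)).2 fun t => ?_
      refine (Φ.le_opNorm (translate f t)).trans ?_
      gcongr
      exact (ContinuousMap.norm_le _ (norm_nonneg f)).2 fun s => f.norm_coe_le_norm _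

end Conv

/-- The point mass `δ_s` in `M(S)`. -/
def dirac (s : S) : M S := ContinuousMap.evalCLM ℂ s

/-! ### Compactifications of `ℤ` and induced preduals -/

/-- The canonical copy in `M(S)` of an element of `ℓ¹(ℤ)`: the measure `∑ n, a n • δ_{φ n}`. -/
def inclusion (φ : ℤ → S) (a : Ell1) : M S :=
  have hb : ∀ (f : C(S, ℂ)) (n : ℤ), ‖a n * f (φ n)‖ ≤ ‖a n‖ * ‖f‖ := fun f n => by
    rw [norm_mul]
    gcongr
    exact f.norm_coe_le_norm _
  have hs : ∀ f : C(S, ℂ), Summable fun n => a n * f (φ n) := fun f =>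
    Summable.of_norm_bounded (a.summable_norm.mul_right ‖f‖) (hb f)
  LinearMap.mkContinuous
    { toFun := fun f => ∑' n : ℤ, a n * f (φ n)
      map_add' := fun f g => by
        rw [← (hs f).tsum_add (hs g)]
        simp [mul_add]
      map_smul' := fun c f => by
        rw [RingHom.id_apply, smul_eq_mul, ← tsum_mul_left]
        simp [mul_left_comm] }
    ‖a‖ fun f => by
      rw [a.norm_eq, ← tsum_mul_right]
      exact tsum_of_norm_bounded (a.summable_norm.mul_right ‖f‖).hasSum (hb f)

/-- A map `φ` that makes the compact space `S` a semigroup compactification of `ℤ`: an injective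
semigroup homomorphism with dense range. -/
structure IsCompactification [AddSemigroup S] (φ : ℤ → S) : Prop where
  map_add : ∀ m n : ℤ, φ (m + n) = φ m + φ n
  injective : Function.Injective φ
  denseRange : DenseRange φ

/-- The preannihilator in `C(S)` of the kernel of `Θ`. -/
def preannKer (Θ : M S →L[ℂ] Ell1) : Submodule ℂ C(S, ℂ) where
  carrier := {f | ∀ Ψ : M S, Θ Ψ = 0 → Ψ f = 0}
  add_mem' := fun {f g} hf hg Ψ hΨ => by rw [_root_.map_add, hf Ψ hΨ, hg Ψ hΨ, add_zero]
  zero_mem' := fun Ψ _ => map_zero Ψ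
  smul_mem' := fun c f hf Ψ hΨ => by rw [map_smul, hf Ψ hΨ, smul_zero]

/-- Restriction of continuous functions on `S` to (the copy under `φ` of) `ℤ`. -/
def restrict (φ : ℤ → S) : C(S, ℂ) →ₗ[ℂ] EllInf where
  toFun := fun f => ⟨fun n => f (φ n), memℓp_infty ⟨‖f‖, by
    rintro _ ⟨n, rfl⟩
    exact f.norm_coe_le_norm _⟩⟩
  map_add' := fun _ _ => rfl
  map_smul' := fun _ _ => rfl

/-- The pair `(S, Θ)` induces the subspace `E` of `ℓ^∞(ℤ)`: `S`, with the map `φ`, is a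
semitopological semigroup compactification of `ℤ`, the bounded operator `Θ : M(S) → ℓ¹(ℤ)` is a
projection and a homomorphism for convolution, its kernel is weak*-closed, and `E` is the
preannihilator of this kernel, restricted to `ℤ`. -/
structure Induces [AddSemigroup S] [SeparatelyContinuousAdd S] [T2Space S]
    (φ : ℤ → S) (Θ : M S →L[ℂ] Ell1) (E : Submodule ℂ EllInf) : Prop where
  compactification : IsCompactification φ
  projection : ∀ a : Ell1, Θ (inclusion φ a) = a
  map_conv : ∀ Φ Ψ : M S, (Θ (conv Φ Ψ) : ℤ → ℂ) = ell1Conv (Θ Φ) (Θ Ψ)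
  isClosed_ker : IsClosed {Ψ : WeakDual ℂ C(S, ℂ) | Θ (WeakDual.toStrongDual Ψ) = 0}
  eq_preannKer : E = (preannKer Θ).map (restrict φ)

/-- The pair `(S, Θ)` is minimal: the points of `S` are separated by `s ↦ Θ(δ_s)`. -/
def IsMinimal (Θ : M S →L[ℂ] Ell1) : Prop := Function.Injective fun s : S => Θ (dirac s)

end Semigroup

/-- The positive multiples of `γ` in a semigroup: `posMultiple γ n = (n + 1) γ`. -/
def posMultiple {S : Type*} [AddSemigroup S] (γ : S) : ℕ → S
  | 0 => γ
  | n + 1 => posMultiple γ n + γ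

end ShiftPredual

end

/-!
Write `τ(s) = Θ(δ_s)`; this is an injective semigroup homomorphism from `S` to the convolution
algebra `ℓ¹(ℤ)`, with `τ(φ n) = δ_n`.

An idempotent of `S` is sent by `τ` to an idempotent of `ℓ¹(ℤ)`. The Fourier series of the latter is
a continuous `{0, 1}`-valued function on the circle, so only `δ_0` and `0` are possible
(`eq_zero_or_eq_single_of_idempotent`), and by injectivity `S` has at most one idempotent besides
`0`, namely the point `∞` with `τ(∞) = 0`. Any such point is a semigroup zero.

For existence, the closure of the positive multiples of any `γ` is a compact semigroup, so it
contains an idempotent (`exists_idempotent_mem_closure`), and it remains to see that this idempotent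
is not `0` unless `γ = 0`. The decisive fact is that `0` is isolated in `S`
(`Induces.isOpen_singleton_zero`). It follows from the Baire category theorem: `ℓ¹(ℤ)` is separable
and `ker Θ` is weak*-closed, so countably many closed sets with images of small norm diameter under
`τ` cover `S`, and one of them has interior; since distinct `δ_n` are far apart, this interior is a
single integer. Now if `0` is a limit of positive multiples of `γ`, it is equal to one of them, so
`γ` is invertible; then `γ` is isolated as well, thus an integer, of finite order, thus `0`.
-/

noncomputable section

namespace ShiftPredual

open Filter Topology MeasureTheory
open scoped NNReal ENNReal Pointwise

/-! ### Idempotents of `ℓ¹(ℤ)` -/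

/-- The Fourier series of an element of `ℓ¹(ℤ)` converges absolutely and uniformly. -/
theorem hasSum_fourier (a : Ell1) :
    HasSum (fun n => a n • (fourier n : C(AddCircle (1 : ℝ), ℂ)))
      (∑' n, a n • (fourier n : C(AddCircle (1 : ℝ), ℂ))) := by
  refine (Summable.of_norm_bounded a.summable_norm fun n => ?_).hasSum
  rw [norm_smul]
  exact (mul_le_of_le_one_right (norm_nonneg _) (by simp [fourier_norm]))

/-- The Fourier transform of `a ∈ ℓ¹(ℤ)`: the continuous function `x ↦ ∑ n, a n * exp (2πinx)` on
the circle `ℝ / ℤ`. -/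
def fourierSeries (a : Ell1) : C(AddCircle (1 : ℝ), ℂ) := ∑' n, a n • fourier n

theorem hasSum_fourierSeries (a : Ell1) (x : AddCircle (1 : ℝ)) :
    HasSum (fun n => a n * fourier n x) (fourierSeries a x) :=
  (hasSum_fourier a).map (ContinuousMap.evalCLM ℂ x) (ContinuousMap.evalCLM ℂ x).continuous

theorem fourierSeries_injective : Function.Injective fourierSeries := by
  -- The coefficients of `a` are the `L²` inner products of its Fourier series with the characters.
  have key : ∀ (a : Ell1) (m : ℤ), a m = inner ℂ (fourierLp (T := 1) 2 m)
      (ContinuousMap.toLp (E := ℂ) 2 AddCircle.haarAddCircle ℂ (fourierSeries a)) := by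
    intro a m
    let g := (innerSL ℂ (fourierLp (T := 1) 2 m)).comp
      (ContinuousMap.toLp (E := ℂ) 2 (AddCircle.haarAddCircle (T := 1)) ℂ)
    have h := (hasSum_fourier a).map g g.continuous
    have h2 := hasSum_single (f := fun n => g (a n • fourier n)) m (fun n hn => by
      have : inner ℂ (fourierLp (T := 1) 2 m) (fourierLp (T := 1) 2 n) = 0 :=
        orthonormal_fourier.2 hn.symm
      simpa [g] using Or.inr this)
    have h3 : g (a m • fourier m) = a m := by
      have : inner ℂ (fourierLp (T := 1) 2 m) (fourierLp (T := 1) 2 m) = 1 := by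
        rw [inner_self_eq_norm_sq_to_K, orthonormal_fourier.1 m]; simp
      change inner ℂ (fourierLp (T := 1) 2 m)
        (ContinuousMap.toLp (E := ℂ) 2 _ ℂ (a m • fourier m)) = a m
      rw [map_smul, inner_smul_right]
      exact (congrArg (a m * ·) this).trans (mul_one _)
    rw [h3] at h2
    exact h2.unique h
  intro a b hab
  ext m
  rw [key a, key b, hab]

/-- The Cauchy product over `ℤ` of two absolutely convergent series. -/
theorem tsum_mul_tsum_eq_tsum_tsum_sub {u v : ℤ → ℂ} (hu : Summable fun n => ‖u n‖)
    (hv : Summable fun n => ‖v n‖) :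
    (∑' n, u n) * ∑' n, v n = ∑' n : ℤ, ∑' k : ℤ, u k * v (n - k) := by
  let e : ℤ × ℤ ≃ ℤ × ℤ :=
    { toFun := fun p => (p.2, p.1 - p.2)
      invFun := fun p => (p.1 + p.2, p.1)
      left_inv := fun p => by simp
      right_inv := fun p => by simp }
  have hge : Summable fun p : ℤ × ℤ => u p.2 * v (p.1 - p.2) :=
    e.summable_iff.2 (summable_mul_of_summable_norm hu hv)
  rw [tsum_mul_tsum_of_summable_norm hu hv, ← hge.tsum_prod]
  exact (e.tsum_eq fun p => u p.1 * v p.2).symm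

theorem fourierSeries_mul {a b c : Ell1} (h : (c : ℤ → ℂ) = ell1Conv a b) :
    fourierSeries c = fourierSeries a * fourierSeries b := by
  ext x
  have hs : ∀ a : Ell1, Summable fun n => ‖a n * fourier n x‖ := fun a => by
    simpa only [norm_mul, fourier_apply, Circle.norm_coe, mul_one] using a.summable_norm
  rw [ContinuousMap.mul_apply, ← (hasSum_fourierSeries a x).tsum_eq,
    ← (hasSum_fourierSeries b x).tsum_eq, ← (hasSum_fourierSeries c x).tsum_eq,
    tsum_mul_tsum_eq_tsum_tsum_sub (hs a) (hs b)]
  refine tsum_congr fun n => ?_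
  rw [h, ell1Conv, ← tsum_mul_right]
  refine tsum_congr fun k => ?_
  have hk : (fourier n x : ℂ) = fourier k x * fourier (n - k) x := by
    rw [← fourier_add, add_sub_cancel]
  rw [hk]
  ring

/-- The only idempotents of the convolution algebra `ℓ¹(ℤ)` are `0` and `δ_0`: the Fourier series of
an idempotent takes values in `{0, 1}`, so it is constant because the circle is connected. -/
theorem eq_zero_or_eq_single_of_idempotent {a : Ell1} (h : (a : ℤ → ℂ) = ell1Conv a a) :
    a = 0 ∨ a = lp.single 1 0 1 := by
  have hF : ∀ x, fourierSeries a x = 0 ∨ fourierSeries a x = 1 := fun x => by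
    have h1 := DFunLike.congr_fun (fourierSeries_mul h) x
    have : fourierSeries a x * (fourierSeries a x - 1) = 0 := by
      rw [ContinuousMap.mul_apply] at h1
      linear_combination -h1
    rcases mul_eq_zero.1 this with h | h
    · exact .inl h
    · exact .inr (sub_eq_zero.1 h)
  have hconst : ∀ x y, fourierSeries a x = fourierSeries a y := by
    have hfin : (Set.range (fourierSeries a)).Finite :=
      (Set.toFinite {0, 1}).subset (Set.range_subset_iff.2 hF)
    have := (isPreconnected_range (fourierSeries a).continuous).isDiscrete_iff_subsingleton.1
      hfin.isDiscrete
    exact fun x y => this ⟨x, rfl⟩ ⟨y, rfl⟩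
  rcases hF 0 with h0 | h0
  · left
    apply fourierSeries_injective
    ext x
    rw [hconst x 0, h0]
    refine HasSum.unique ?_ (hasSum_fourierSeries 0 x)
    simp
  · right
    apply fourierSeries_injective
    ext x
    rw [hconst x 0, h0]
    refine HasSum.unique ?_ (hasSum_fourierSeries _ x)
    convert hasSum_single
      (f := fun n => (lp.single 1 0 1 : Ell1) n * fourier n x) 0 ?_ using 1
    · simp
    · intro n hn
      simp [lp.single_apply, hn]

/-! ### Point masses and closed sets of points of `S` -/

theorem exists_countable_dense_ell1 : ∃ D : Set Ell1, D.Countable ∧ Dense D := by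
  have h1 : TopologicalSpace.IsSeparable
      (closure (Submodule.span ℂ (Set.range fun n : ℤ => (lp.single 1 n 1 : Ell1)) : Set Ell1)) :=
    ((Set.countable_range _).isSeparable.span (R := ℂ)).closure
  have h2 : closure (Submodule.span ℂ (Set.range fun n : ℤ => (lp.single 1 n 1 : Ell1)) : Set Ell1)
      = Set.univ := by
    refine Set.eq_univ_of_forall fun a => ?_
    refine mem_closure_of_tendsto (lp.hasSum_single (by simp) a) (.of_forall fun s => ?_)
    refine Submodule.sum_mem _ fun n _ => ?_
    have : (lp.single 1 n (a n) : Ell1) = a n • lp.single 1 n 1 := by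
      rw [← lp.single_smul, smul_eq_mul, mul_one]
    rw [this]
    exact Submodule.smul_mem _ _ (Submodule.subset_span ⟨n, rfl⟩)
  rw [h2] at h1
  have := TopologicalSpace.isSeparable_univ_iff.1 h1
  exact TopologicalSpace.exists_countable_dense _

theorem one_le_norm_single_sub {m n : ℤ} (h : m ≠ n) :
    1 ≤ ‖(lp.single 1 m 1 - lp.single 1 n 1 : Ell1)‖ := by
  refine le_trans ?_ (lp.norm_apply_le_norm one_ne_zero _ m)
  simp [h]

section Compact

variable {S : Type*} [TopologicalSpace S] [CompactSpace S]

theorem dirac_eq_inclusion (φ : ℤ → S) (n : ℤ) : dirac (φ n) = inclusion φ (lp.single 1 n 1) := by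
  ext f
  change f (φ n) = ∑' k : ℤ, (lp.single 1 n 1 : Ell1) k * f (φ k)
  rw [tsum_eq_single n fun k hk => by simp [hk]]
  simp

theorem norm_inclusion_le (φ : ℤ → S) (a : Ell1) : ‖inclusion φ a‖ ≤ ‖a‖ :=
  ContinuousLinearMap.opNorm_le_bound _ (norm_nonneg a) fun f => by
    rw [a.norm_eq, ← tsum_mul_right]
    refine tsum_of_norm_bounded (a.summable_norm.mul_right ‖f‖).hasSum fun n => ?_
    rw [norm_mul]
    gcongr
    exact f.norm_coe_le_norm _

theorem continuous_dirac : Continuous fun s : S => StrongDual.toWeakDual (dirac s) :=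
  WeakDual.continuous_of_continuous_eval fun f => f.continuous

/-- The points `s` for which `Θ(δ_s)` lies in the image under `Θ` of the ball of radius `r` about
`Φ` form a closed set: the measures congruent modulo `ker Θ` to an element of the ball are the sum
of a weak*-closed and a weak*-compact set. Such images replace the norm balls of `ℓ¹(ℤ)`, which
need not be weak*-closed for the induced predual. -/
theorem isClosed_setOf_near (Θ : M S →L[ℂ] Ell1)
    (hΘ : IsClosed {Ψ : WeakDual ℂ C(S, ℂ) | Θ (WeakDual.toStrongDual Ψ) = 0})
    (Φ : M S) (r : ℝ) :
    IsClosed {s : S | ∃ Ψ : M S, ‖Ψ‖ ≤ r ∧ Θ (dirac s) = Θ Φ + Θ Ψ} := by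
  have hc : IsClosed ({Ψ : WeakDual ℂ C(S, ℂ) | Θ (WeakDual.toStrongDual Ψ) = 0} +
      WeakDual.toStrongDual ⁻¹' Metric.closedBall Φ r) :=
    hΘ.add_right_of_isCompact (WeakDual.isCompact_closedBall _ _)
  convert hc.preimage continuous_dirac using 1
  ext s
  simp only [Set.mem_ofPred_eq, Set.mem_preimage, Set.mem_add]
  constructor
  · rintro ⟨Ψ, hΨ, h⟩
    refine ⟨StrongDual.toWeakDual (dirac s - (Φ + Ψ)), ?_, StrongDual.toWeakDual (Φ + Ψ), ?_, ?_⟩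
    · change Θ (dirac s - (Φ + Ψ)) = 0
      rw [map_sub, map_add, h, sub_self]
    · change Φ + Ψ ∈ Metric.closedBall Φ r
      simpa using hΨ
    · rw [← map_add, sub_add_cancel]
  · rintro ⟨Ψ, hΨ, Ψ', hΨ', h⟩
    refine ⟨WeakDual.toStrongDual Ψ' - Φ, by simpa [dist_eq_norm] using hΨ', ?_⟩
    have h' : dirac s = WeakDual.toStrongDual Ψ + WeakDual.toStrongDual Ψ' := by
      rw [← map_add, h]; rfl
    rw [h', map_add, hΨ, map_sub, zero_add, add_sub_cancel]

end Compact

/-! ### The algebra of a compactification of `ℤ` -/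

theorem posMultiple_add {S : Type*} [AddSemigroup S] (γ : S) (m n : ℕ) :
    posMultiple γ m + posMultiple γ n = posMultiple γ (m + n + 1) := by
  induction n with
  | zero => rfl
  | succ n ih => rw [posMultiple, ← add_assoc, ih]; rfl

section Algebra

variable {S : Type*} [AddSemigroup S] [TopologicalSpace S]

theorem IsCompactification.posMultiple_apply {φ : ℤ → S} (hφ : IsCompactification φ) (m : ℤ)
    (n : ℕ) : posMultiple (φ m) n = φ ((n + 1) * m) := by
  induction n with
  | zero => simp [posMultiple]
  | succ n ih =>
    rw [posMultiple, ih, ← hφ.map_add]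
    congr 1
    push_cast
    ring

variable [SeparatelyContinuousAdd S] [T2Space S]

/-- The semigroup `S` is commutative, since `ℤ` is dense and addition is separately continuous. -/
theorem IsCompactification.add_comm {φ : ℤ → S} (hφ : IsCompactification φ) (s t : S) :
    s + t = t + s := by
  have h1 : ∀ (n : ℤ) (s : S), s + φ n = φ n + s := fun n => by
    refine congrFun (f := (· + φ n)) (g := (φ n + ·)) (hφ.denseRange.equalizer ?_ ?_
      (funext fun m => ?_))
    · exact SeparatelyContinuousAdd.continuous_add_const
    · exact SeparatelyContinuousAdd.continuous_const_add
    · simp only [Function.comp_apply, ← hφ.map_add, _root_.add_comm]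
  refine congrFun (f := (s + ·)) (g := (· + s)) (hφ.denseRange.equalizer ?_ ?_
    (funext fun m => h1 m s)) t
  · exact SeparatelyContinuousAdd.continuous_const_add
  · exact SeparatelyContinuousAdd.continuous_add_const

theorem IsCompactification.add_zero {φ : ℤ → S} (hφ : IsCompactification φ) (s : S) :
    s + φ 0 = s := by
  refine congrFun (f := (· + φ 0)) (g := id)
    (hφ.denseRange.equalizer ?_ continuous_id (funext fun m => ?_)) s
  · exact SeparatelyContinuousAdd.continuous_add_const
  · simp [← hφ.map_add]

/-- If `0` is isolated in `S`, every invertible element of `S` is an integer: translations by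
invertible elements are homeomorphisms, so invertible elements are isolated, and `ℤ` is dense. -/
theorem IsCompactification.mem_range_of_add_eq_zero {φ : ℤ → S} (hφ : IsCompactification φ)
    (h0 : IsOpen {φ 0}) {s t : S} (h : s + t = φ 0) : s ∈ Set.range φ := by
  have hpre : (fun u => u + t) ⁻¹' {φ 0} = {s} := by
    ext u
    simp only [Set.mem_preimage, Set.mem_singleton_iff]
    constructor
    · intro hu
      rw [← hφ.add_zero u, ← h, hφ.add_comm s t, ← add_assoc, hu, hφ.add_comm, hφ.add_zero]
    · rintro rfl
      exact h
  have ho : IsOpen {s} := hpre ▸ h0.preimage SeparatelyContinuousAdd.continuous_add_const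
  obtain ⟨n, hn⟩ := hφ.denseRange.exists_mem_open ho (Set.singleton_nonempty s)
  exact ⟨n, hn⟩

/-- If `0` is isolated and a limit of positive multiples of `γ`, then `0` is itself such a
multiple, so `γ` is an invertible element of finite order, that is, an integer of finite order. -/
theorem IsCompactification.eq_zero_of_mem_closure {φ : ℤ → S} (hφ : IsCompactification φ)
    (h0 : IsOpen {φ 0}) {γ : S} (h : φ 0 ∈ closure (Set.range (posMultiple γ))) : γ = φ 0 := by
  obtain ⟨_, hx, n, rfl⟩ := mem_closure_iff.1 h _ h0 rfl
  rw [Set.mem_singleton_iff] at hx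
  cases n with
  | zero => exact hx
  | succ n =>
    obtain ⟨m, rfl⟩ := hφ.mem_range_of_add_eq_zero h0 ((hφ.add_comm _ _).trans hx)
    rw [hφ.posMultiple_apply] at hx
    have := hφ.injective hx
    have : m = 0 := (mul_eq_zero.1 this).resolve_left (by positivity)
    rw [this]

end Algebra

/-! ### The point `0` is isolated -/

section Isolated

variable {S : Type*} [AddSemigroup S] [TopologicalSpace S] [CompactSpace S]
  [SeparatelyContinuousAdd S] [T2Space S]

/-- The point `0` is isolated in `S`. By Baire, some nonempty open set has an image of small
diameter under `s ↦ Θ(δ_s)`; it can contain only one integer, so by density that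
integer is isolated, and translation does the rest. -/
theorem Induces.isOpen_singleton_zero {φ : ℤ → S} {Θ : M S →L[ℂ] Ell1} {E : Submodule ℂ EllInf}
    (hE : Induces φ Θ E) : IsOpen {φ 0} := by
  obtain ⟨D, hDc, hD⟩ := exists_countable_dense_ell1
  obtain ⟨r, hr, hrΘ⟩ : ∃ r : ℝ, 0 < r ∧ ‖Θ‖ * r < 1 / 2 :=
    ⟨1 / (2 * (‖Θ‖ + 1)), by positivity, by
      rw [mul_one_div, div_lt_div_iff₀ (by positivity) two_pos]; linarith⟩
  have := hDc.to_subtype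
  have : Nonempty S := ⟨φ 0⟩
  -- Some set of this countable closed cover of the Baire space `S` has an interior point.
  obtain ⟨⟨a, haD⟩, hne⟩ := nonempty_interior_of_iUnion_of_closed
    (f := fun a : D => {s : S | ∃ Ψ : M S, ‖Ψ‖ ≤ r ∧ Θ (dirac s) = Θ (inclusion φ a) + Θ Ψ})
    (fun a => isClosed_setOf_near Θ hE.isClosed_ker _ r) (by
      refine Set.eq_univ_of_forall fun s => Set.mem_iUnion.2 ?_
      obtain ⟨a, haD, ha⟩ := hD.exists_dist_lt (Θ (dirac s)) hr
      refine ⟨⟨a, haD⟩, inclusion φ (Θ (dirac s) - a), ?_, ?_⟩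
      · exact (norm_inclusion_le _ _).trans (dist_eq_norm (Θ (dirac s)) a ▸ ha.le)
      · simp [hE.projection])
  obtain ⟨U, hUo, hUne, hUsub⟩ : ∃ U : Set S, IsOpen U ∧ U.Nonempty ∧
      U ⊆ {s : S | ∃ Ψ : M S, ‖Ψ‖ ≤ r ∧ Θ (dirac s) = Θ (inclusion φ a) + Θ Ψ} :=
    ⟨_, isOpen_interior, hne, interior_subset⟩
  obtain ⟨m, hm⟩ := hE.compactification.denseRange.exists_mem_open hUo hUne
  have hnear : ∀ n, φ n ∈ U → ‖(lp.single 1 n 1 - a : Ell1)‖ < 1 / 2 := fun n hn => by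
    obtain ⟨Ψ, hΨ, h⟩ := hUsub hn
    rw [dirac_eq_inclusion, hE.projection, hE.projection] at h
    rw [h, add_sub_cancel_left]
    exact ((Θ.le_opNorm Ψ).trans (by gcongr)).trans_lt hrΘ
  -- Distinct point masses are far apart, so `U` contains only one integer; by density of the
  -- integers in the open set `U`, it contains nothing else.
  have huniq : ∀ n, φ n ∈ U → n = m := fun n hn => by
    by_contra hne
    have h1 := one_le_norm_single_sub hne
    have h2 := norm_sub_le_norm_sub_add_norm_sub (lp.single 1 n 1 : Ell1) a (lp.single 1 m 1)
    have h3 := hnear n hn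
    have h4 := hnear m hm
    rw [norm_sub_rev] at h4
    linarith
  have hUm : U = {φ m} := by
    refine Set.Subset.antisymm (fun s hs => ?_) (Set.singleton_subset_iff.2 hm)
    have h1 := hE.compactification.denseRange.open_subset_closure_inter hUo hs
    refine closure_minimal ?_ isClosed_singleton h1
    rintro _ ⟨hx, n, rfl⟩
    rw [huniq n hx]; rfl
  -- Translation by `φ m` carries the isolated point `φ m` to `φ 0`.
  have hpre : (fun s => s + φ m) ⁻¹' U = {φ 0} := by
    ext s
    simp only [hUm, Set.mem_preimage, Set.mem_singleton_iff]
    constructor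
    · intro h
      have := congrArg (· + φ (-m)) h
      simpa [add_assoc, ← hE.compactification.map_add, hE.compactification.add_zero] using this
    · rintro rfl
      rw [← hE.compactification.map_add, _root_.zero_add]
  rw [← hpre]
  exact hUo.preimage SeparatelyContinuousAdd.continuous_add_const

/-- The closure of the multiples of `γ` is a compact semigroup, so the Ellis–Numakura lemma yields an
idempotent in it. -/
theorem exists_idempotent_mem_closure (γ : S) :
    ∃ e ∈ closure (Set.range (posMultiple γ)), e + e = e := by
  refine exists_idempotent_in_compact_add_subsemigroup
    (fun _ => SeparatelyContinuousAdd.continuous_add_const) _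
    (Set.range_nonempty _).closure isClosed_closure.isCompact ?_
  have h1 : ∀ x ∈ closure (Set.range (posMultiple γ)), ∀ n,
      x + posMultiple γ n ∈ closure (Set.range (posMultiple γ)) := fun x hx n =>
    map_mem_closure (f := (· + posMultiple γ n))
      SeparatelyContinuousAdd.continuous_add_const hx (by
        rintro _ ⟨m, rfl⟩
        exact ⟨_, (posMultiple_add γ m n).symm⟩)
  intro x hx y hy
  have := map_mem_closure (f := (x + ·)) (t := closure (Set.range (posMultiple γ)))
    SeparatelyContinuousAdd.continuous_const_add hy (by
      rintro _ ⟨n, rfl⟩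
      exact h1 x hx n)
  rwa [closure_closure] at this

end Isolated

end ShiftPredual

end

theorem lemma4p8 {S : Type*} [AddSemigroup S] [TopologicalSpace S] [CompactSpace S] [T2Space S]
    [SeparatelyContinuousAdd S] (φ : ℤ → S) (Θ : ShiftPredual.M S →L[ℂ] ShiftPredual.Ell1)
    (E : Submodule ℂ ShiftPredual.EllInf) (hE : ShiftPredual.Induces φ Θ E)
    (hmin : ShiftPredual.IsMinimal Θ) :
    ∃ infty : S, infty ≠ φ 0 ∧
      (∀ e : S, e + e = e ↔ e = φ 0 ∨ e = infty) ∧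
      (∀ γ : S, infty + γ = infty ∧ γ + infty = infty) ∧
      ∀ γ : S, γ ≠ φ 0 → infty ∈ closure (Set.range (ShiftPredual.posMultiple γ)) := by
  open ShiftPredual in
  have hφ := hE.compactification
  have hadd : ∀ s t : S, (Θ (dirac (s + t)) : ℤ → ℂ) = ell1Conv (Θ (dirac s)) (Θ (dirac t)) :=
    fun s t => hE.map_conv (dirac s) (dirac t)
  have hzero : Θ (dirac (φ 0)) = lp.single 1 0 1 := by
    rw [dirac_eq_inclusion, hE.projection]
  have hidem : ∀ e : S, e + e = e → e = φ 0 ∨ Θ (dirac e) = 0 := by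
    intro e he
    have h := hadd e e
    rw [he] at h
    rcases eq_zero_or_eq_single_of_idempotent h with h0 | h1
    · exact .inr h0
    · exact .inl (hmin (h1.trans hzero.symm))
  have hex : ∀ γ : S, γ ≠ φ 0 →
      ∃ e ∈ closure (Set.range (posMultiple γ)), Θ (dirac e) = 0 := by
    intro γ hγ
    obtain ⟨e, hmem, he⟩ := exists_idempotent_mem_closure γ
    refine ⟨e, hmem, (hidem e he).resolve_left ?_⟩
    rintro rfl
    exact hγ (hφ.eq_zero_of_mem_closure hE.isOpen_singleton_zero hmem)
  obtain ⟨infty, -, hinf⟩ := hex (φ 1) (hφ.injective.ne one_ne_zero)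
  have huniq : ∀ e : S, Θ (dirac e) = 0 → e = infty := fun e he => hmin (he.trans hinf.symm)
  have habs : ∀ γ : S, infty + γ = infty := by
    refine fun γ => huniq _ (lp.ext ?_)
    rw [hadd, hinf]
    ext n
    simp [ell1Conv]
  refine ⟨infty, ?_, fun e => ⟨fun he => (hidem e he).imp_right (huniq e), ?_⟩,
    fun γ => ⟨habs γ, (hφ.add_comm _ _).trans (habs γ)⟩, fun γ hγ => ?_⟩
  · rintro rfl
    have h := hzero.symm.trans hinf
    have : (1 : ℂ) = 0 := by simpa using congrArg (fun a : Ell1 => a 0) h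
    exact one_ne_zero this
  · rintro (rfl | rfl)
    · rw [← hφ.map_add, add_zero]
    · exact habs e
  · obtain ⟨e, hmem, he⟩ := hex γ hγ
    exact huniq e he ▸ hmem
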